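/- Let $K$ be a field. For a finite simple graph $G$ with vertex set $V$, let $J_G$ be its binomial edge ideal, i.e. the ideal of the polynomial ring $K[x_v,y_v : v\in V]$ generated by the binomials $x_iy_j-x_jy_i$ with $\{i,j\}$ an edge of $G$. A vertex of a graph is a cut point if deleting it gives a graph with more connected components. Let $\mathcal{C}(G)$ be the collection consisting of $\emptyset$ and of all $T\subseteq V$ such that every $i\in T$ is a cut point of the subgraph of $G$ induced on $(V\setminus T)\cup\{i\}$. For collections $\mathcal{A},\mathcal{B}$ of sets put $\mathcal{A}\circ\mathcal{B}=\{A\cup B : A\in\mathcal{A},\,B\in\mathcal{B}\}$, and $\bigcirc_{i=1}^{t}\mathcal{A}_i=\{A_1\cup\dots\cup A_t : A_i\in\mathcal{A}_i\}$. The join $G_1*G_2$ of two graphs on disjoint vertex sets is obtained from their disjoint union by adding all edges between a vertex of $G_1$ and a vertex of $G_2$. Proposition 4.10. Let $G_1=\bigsqcup_{i=1}^{r}G_{1i}$ and $G_2=\bigsqcup_{j=1}^{s}G_{2j}$ be finite simple graphs on disjoint vertex sets $V_1$ and $V_2$, where $G_{11},\dots,G_{1r}$ are the connected components of $G_1$,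 $G_{21},\dots,G_{2s}$ are the connected components of $G_2$, and $r,s\ge 2$. Let $V_{1i}$, $V_{2j}$ be the vertex sets of $G_{1i}$, $G_{2j}$, and put $n_1=|V_1|$, $n_2=|V_2|$, $S=K[x_v,y_v : v\in V_1\cup V_2]$, $S_{1i}=K[x_v,y_v : v\in V_{1i}]$, $S_{2j}=K[x_v,y_v : v\in V_{2j}]$. Then: (a) $\mathcal{C}(G_1*G_2)=\{\emptyset\}\cup\Big(\big(\bigcirc_{i=1}^{r}\mathcal{C}(G_{1i})\big)\circ\{V_2\}\Big)\cup\Big(\big(\bigcirc_{j=1}^{s}\mathcal{C}(G_{2j})\big)\circ\{V_1\}\Big)$; (b) $\operatorname{height} J_{G_1*G_2}=\min\Big\{2n_2+\sum_{i=1}^{r}\operatorname{height}J_{G_{1i}},\ 2n_1+\sum_{j=1}^{s}\operatorname{height}J_{G_{2j}},\ n_1+n_2-1\Big\}$; (c) $\dim S/J_{G_1*G_2}=\max\Big\{\sum_{i=1}^{r}\dim S_{1i}/J_{G_{1i}},\ \sum_{j=1}^{s}\dim S_{2j}/J_{G_{2j}},\ n_1+n_2+1\Big\}$. -/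

import Mathlib

/-- A vertex `v` of a (finite) graph `G` is a cut point if deleting `v` from `G` yields a graph
with more connected components than `G`. -/
def IsCutPoint {V : Type*} (G : SimpleGraph V) (v : V) : Prop :=
  Nat.card G.ConnectedComponent < Nat.card (G.induce {w | w ≠ v}).ConnectedComponent

/-- `T` has the cut point property for `G`: every `i ∈ T` is a cut point of the subgraph of `G`
induced on `(V \ T) ∪ {i}`. -/
def HasCutPointProperty {V : Type*} (G : SimpleGraph V) (T : Set V) : Prop :=
  ∀ i ∈ T, IsCutPoint (G.induce (Tᶜ ∪ {i})) ⟨i, Or.inr rfl⟩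

/-- The collection `𝒞(G)`: the empty set together with the sets having the cut point property. -/
def cutPointSets {V : Type*} (G : SimpleGraph V) : Set (Set V) :=
  {∅} ∪ {T | HasCutPointProperty G T}

/-- The join `G * H`: the disjoint union of `G` and `H` together with all edges between them. -/
def graphJoin {V W : Type*} (G : SimpleGraph V) (H : SimpleGraph W) : SimpleGraph (V ⊕ W) :=
  SimpleGraph.sum G H ⊔ completeBipartiteGraph V W

/-- The join `𝒜 ∘ ℬ = {A ∪ B : A ∈ 𝒜, B ∈ ℬ}` of two collections of subsets. -/
def joinCollections {V : Type*} (𝒜 ℬ : Set (Set V)) : Set (Set V) :=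
  {T | ∃ A ∈ 𝒜, ∃ B ∈ ℬ, T = A ∪ B}

/-- The join `○ᵢ 𝒜ᵢ = {⋃ᵢ Aᵢ : Aᵢ ∈ 𝒜ᵢ}` of a family of collections of subsets. -/
def iJoinCollections {ι V : Type*} (𝒜 : ι → Set (Set V)) : Set (Set V) :=
  {T | ∃ A : ι → Set V, (∀ i, A i ∈ 𝒜 i) ∧ T = ⋃ i, A i}

/-- The collection of subsets of `V` obtained by viewing the members of `𝒜`, which are sets of
vertices of the connected component `c`, as subsets of `V`. -/
def liftCollection {V : Type*} {G : SimpleGraph V} (c : G.ConnectedComponent)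
    (𝒜 : Set (Set c)) : Set (Set V) :=
  {T | ∃ A ∈ 𝒜, T = Subtype.val '' A}

/-- `K[x_v, y_v : v ∈ V]`; the variable `x_v` is indexed by `(0, v)` and `y_v` by `(1, v)`. -/
abbrev EdgeRing (K : Type*) [Field K] (V : Type*) : Type _ :=
  MvPolynomial (Fin 2 × V) K

/-- The binomial edge ideal `J_G`, generated by `x_i y_j - x_j y_i` for the edges `{i, j}` of `G`.
Exchanging `i` and `j` only changes the sign of the generator, so no order on `V` is needed. -/
noncomputable def binomialEdgeIdeal (K : Type*) [Field K] {V : Type*} (G : SimpleGraph V) :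
    Ideal (EdgeRing K V) :=
  Ideal.span {f | ∃ i j, G.Adj i j ∧
    f = MvPolynomial.X (0, i) * MvPolynomial.X (1, j)
      - MvPolynomial.X (0, j) * MvPolynomial.X (1, i)}

/-! Everything reduces to counting components of induced subgraphs. Let d(G) be the maximum of |U| +
c(U) over vertex sets U, with c(U) the number of components of G[U]. Then dim S/J_G = d(G) and
height J_G = 2|V| - d(G) (`binomialEdgeIdeal_height_add_eq_and_dim_eq`). Modulo a prime over J_G,
let U be the vertices with (x_v, y_v) ≠ 0. The ratio x_v : y_v is constant on components of G[U], so
all variables are polynomials in |U| + c(U) parameters, which bounds the height below. Conversely,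
specialising these parameters one at a time gives a chain of |U| + c(U) strict inclusions of primes
over J_G. The number d is additive over connected components. In a join, a set U meeting both sides
is connected, so only U inside one side and U = V₁ ∪ V₂ matter for d; this gives (b) and (c). The
same dichotomy, applied to the complement of T, gives (a): T is empty or contains a whole side, and
r, s ≥ 2 make every vertex of that side a cut point. -/

/-! ### Heights of primes in polynomial rings and algebraic independence. -/

open MvPolynomial in
theorem ker_aeval_option_comap {K A σ : Type*} [Field K] [CommRing A] [Algebra K A]
    (f : Option σ → A) :
    RingHom.ker (aeval f : MvPolynomial (Option σ) K →ₐ[K] A) =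
      (RingHom.ker (Polynomial.eval₂RingHom
        (aeval (f ∘ some) : MvPolynomial σ K →ₐ[K] A).toRingHom (f none))).comap
        (optionEquivLeft K σ).toRingEquiv := by
  have : (aeval f : MvPolynomial (Option σ) K →ₐ[K] A).toRingHom =
      (Polynomial.eval₂RingHom (aeval (f ∘ some) : MvPolynomial σ K →ₐ[K] A).toRingHom
        (f none)).comp (optionEquivLeft K σ).toRingEquiv.toRingHom := by
    refine MvPolynomial.ringHom_ext (fun r => ?_) (fun i => ?_)
    · simp [optionEquivLeft_apply, MvPolynomial.algebraMap_eq,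
        Polynomial.algebraMap_apply]
    · cases i <;> simp [optionEquivLeft_apply]
  exact congrArg RingHom.ker this

/-- Going-down makes height additive: P contributes the height of its image in R[X]/pR[X], a nonzero
ideal of a domain. -/
theorem Polynomial.height_add_one_le_of_ne_map {R : Type*} [CommRing R] [IsNoetherianRing R]
    (p : Ideal R) [p.IsPrime] (P : Ideal (Polynomial R)) [P.IsPrime]
    (hp : p = P.comap Polynomial.C) (hne : ¬ P ≤ p.map Polynomial.C) :
    p.height + 1 ≤ P.height := by
  have : P.LiesOver p := ⟨hp⟩
  rw [Ideal.height_eq_height_add_of_liesOver_of_hasGoingDown p P]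
  gcongr
  have hprime : (p.map (algebraMap R (Polynomial R))).IsPrime :=
    Ideal.isPrime_map_C_of_isPrime
  rw [Order.one_le_iff_ne_zero, Ne, Ideal.height_eq_zero_iff_eq_bot, Ideal.map_eq_bot_iff_le_ker,
    Ideal.mk_ker]
  exact hne

theorem Polynomial.height_comap_C_le {R : Type*} [CommRing R] [IsNoetherianRing R]
    (p : Ideal R) [p.IsPrime] (P : Ideal (Polynomial R)) [P.IsPrime]
    (hp : p = P.comap Polynomial.C) : p.height ≤ P.height := by
  have : P.LiesOver p := ⟨hp⟩
  rw [Ideal.height_eq_height_add_of_liesOver_of_hasGoingDown p P]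
  exact le_self_add

/-- The image of the variables under a map to a domain contains an algebraically independent
family whose size is at least the number of variables minus the height of the kernel. -/
theorem exists_algebraicIndependent_card_le_height_add {K A σ : Type*} [Field K] [CommRing A]
    [IsDomain A] [Algebra K A] [Finite σ] (f : σ → A) :
    ∃ (m : ℕ) (b : Fin m → σ), AlgebraicIndependent K (f ∘ b) ∧
      (Nat.card σ : ℕ∞) ≤
        (RingHom.ker (MvPolynomial.aeval f : MvPolynomial σ K →ₐ[K] A)).height + m := by
  induction σ using Finite.induction_empty_option with
  | of_equiv e H =>
    obtain ⟨m, b, hb, hle⟩ := H (f ∘ e)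
    refine ⟨m, e ∘ b, hb, ?_⟩
    rw [← Nat.card_congr e]
    refine hle.trans_eq ?_
    rw [← RingEquiv.height_comap (MvPolynomial.renameEquiv K e).toRingEquiv]
    congr 2
    ext p
    simp [RingHom.mem_ker, MvPolynomial.aeval_rename]
  | h_empty => exact ⟨0, Fin.elim0, algebraicIndependent_empty_type, by simp⟩
  | @h_option σ _ H =>
    obtain ⟨m, b, hb, hle⟩ := H (f ∘ some)
    rw [ker_aeval_option_comap, RingEquiv.height_comap]
    set φ := (MvPolynomial.aeval (f ∘ some) : MvPolynomial σ K →ₐ[K] A) with hφ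
    set P := RingHom.ker (Polynomial.eval₂RingHom φ.toRingHom (f none)) with hP
    have hPp : RingHom.ker φ = P.comap Polynomial.C := by
      ext p
      simp [hP, RingHom.mem_ker]
    have hcard : (Nat.card (Option σ) : ℕ∞) = Nat.card σ + 1 := by
      simp
    have : P.IsPrime := RingHom.ker_isPrime _
    have : (RingHom.ker φ).IsPrime := RingHom.ker_isPrime _
    -- Either P is extended from the smaller ring and the new value is transcendental, enlarging the
    -- family, or the height goes up by one.
    by_cases hle' : P ≤ (RingHom.ker φ).map Polynomial.C
    · have htr : Transcendental (Algebra.adjoin K (Set.range ((f ∘ some) ∘ b))) (f none) := by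
        have hsub : Algebra.adjoin K (Set.range ((f ∘ some) ∘ b)) ≤ φ.range := by
          refine Algebra.adjoin_le ?_
          rintro _ ⟨i, rfl⟩
          exact ⟨MvPolynomial.X (b i), by simp [hφ]⟩
        rw [transcendental_iff]
        intro q hq
        have hlift : ∀ a : Algebra.adjoin K (Set.range ((f ∘ some) ∘ b)),
            ∃ r : MvPolynomial σ K, φ r = a := fun a => hsub a.2
        choose g hg using hlift
        -- Lifting the coefficients of the relation `q` gives an element of P; P being extended then
        -- forces each coefficient of `q` to vanish.
        let Q : Polynomial (MvPolynomial σ K) :=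
          ∑ i ∈ Finset.range (q.natDegree + 1), Polynomial.monomial i (g (q.coeff i))
        have hQ : Q ∈ P := by
          rw [hP, RingHom.mem_ker]
          simp only [Q, map_sum, Polynomial.coe_eval₂RingHom, Polynomial.eval₂_monomial]
          rw [Polynomial.aeval_eq_sum_range] at hq
          rw [← hq]
          refine Finset.sum_congr rfl fun i _ => ?_
          simp [hg, Algebra.smul_def]
        have hQ' := Ideal.mem_map_C_iff.1 (hle' hQ)
        ext i
        by_cases hi : i ≤ q.natDegree
        · have := hQ' i
          simp only [Q, Polynomial.finsetSum_coeff, Polynomial.coeff_monomial,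
            RingHom.mem_ker] at this
          rw [Finset.sum_ite_eq' ] at this
          simpa [Nat.lt_succ_iff, hi, hg] using this
        · rw [Polynomial.coeff_eq_zero_of_natDegree_lt (not_le.1 hi)]
          simp
      have hind := (hb.option_iff_transcendental (f none)).2 htr
      let e : Fin (m + 1) ≃ Option (Fin m) := finSuccEquiv m
      refine ⟨m + 1, fun i => (e i).map b, ?_, ?_⟩
      · convert (algebraicIndependent_equiv e).2 hind using 1
        ext i
        simp only [Function.comp_apply]
        cases e i <;> rfl
      · rw [hcard]
        push_cast
        rw [← add_assoc]
        gcongr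
        exact hle.trans (by gcongr; exact Polynomial.height_comap_C_le _ P hPp)
    · refine ⟨m, some ∘ b, hb, ?_⟩
      rw [hcard]
      calc (Nat.card σ : ℕ∞) + 1 ≤ ((RingHom.ker φ).height + m) + 1 := by gcongr
        _ = ((RingHom.ker φ).height + 1) + m := by ring
        _ ≤ _ := by
          gcongr
          exact Polynomial.height_add_one_le_of_ne_map _ P hPp hle'

theorem PrimeSpectrum.height_head_add_length_le {R : Type*} [CommRing R]
    (s : LTSeries (PrimeSpectrum R)) :
    ((s.head.asIdeal.height + s.length : ℕ∞) : WithBot ℕ∞) ≤ ringKrullDim R := by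
  have : Nonempty (PrimeSpectrum R) := ⟨s.head⟩
  rw [ringKrullDim, Order.krullDim_eq_iSup_height_add_coheight_of_nonempty,
    PrimeSpectrum.height_eq_orderHeight]
  refine WithBot.coe_le_coe.2 (le_iSup_of_le s.head ?_)
  gcongr
  exact Order.length_le_coheight_head

/-- If every prime over `I` has height at least `n - d`, where `n` is the dimension of the ring,
and some chain of primes over `I` has length `d`, then `I` has height `n - d` and
the quotient has dimension `d`. -/
theorem Ideal.height_add_eq_and_ringKrullDim_quotient_eq {R : Type*} [CommRing R] {I : Ideal R}
    {n d : ℕ} (hn : ringKrullDim R = n)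
    (hle : ∀ P : Ideal R, P.IsPrime → I ≤ P → (n : ℕ∞) ≤ P.height + d)
    (s : LTSeries (PrimeSpectrum R)) (hs : I ≤ s.head.asIdeal) (hd : s.length = d) :
    I.height + d = n ∧ ringKrullDim (R ⧸ I) = d := by
  have key : ∀ s : LTSeries (PrimeSpectrum R), s.head.asIdeal.height + s.length ≤ n := by
    intro s
    have := PrimeSpectrum.height_head_add_length_le s
    rw [hn] at this
    exact_mod_cast this
  refine ⟨le_antisymm ?_ ?_, le_antisymm ?_ ?_⟩
  · calc I.height + d ≤ s.head.asIdeal.height + s.length := by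
          rw [hd]; gcongr
      _ ≤ n := key s
  -- Moving `d` to the left lets the bound pass to the infimum over minimal primes.
  · have hfin : ∀ a : ℕ∞, (n : ℕ∞) ≤ a + d ↔ ((n - d : ℕ) : ℕ∞) ≤ a := by
      intro a
      induction a using ENat.recTopCoe with
      | top => simp
      | coe a => norm_cast; omega
    rw [hfin, Ideal.height_eq_inf_minimalPrimes]
    exact le_iInf₂ fun P hP => (hfin _).1 (hle P hP.1.1 hP.1.2)
  · refine iSup_le fun t => ?_
    let t' := t.map (PrimeSpectrum.comap (Ideal.Quotient.mk I))
      (RingHom.strictMono_comap_of_surjective Ideal.Quotient.mk_surjective)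
    have h1 : I ≤ t'.head.asIdeal := by
      intro x hx
      simp [t', LTSeries.head_map, Ideal.Quotient.eq_zero_iff_mem.2 hx]
    have h2 := hle _ t'.head.2 h1
    have h3 := key t'
    have h4 : t'.length = t.length := rfl
    rw [h4] at h3
    generalize t'.head.asIdeal.height = a at h2 h3
    induction a using ENat.recTopCoe with
    | top => simp at h3
    | coe a =>
      norm_cast at h2 h3 ⊢
      omega
  · rw [ringKrullDim_quotient, ← hd]
    let t : LTSeries (PrimeSpectrum.zeroLocus (R := R) I) :=
      ⟨s.length, fun i => ⟨s i, hs.trans (s.monotone (Fin.zero_le i))⟩, fun i => s.step i⟩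
    exact le_iSup (fun s : LTSeries _ => (s.length : WithBot ℕ∞)) t

/-! ### Dimension and height of a binomial edge ideal. -/

/-- The number of connected components of the subgraph induced on `U`. -/
noncomputable def SimpleGraph.numComponents {V : Type*} (G : SimpleGraph V) (U : Set V) : ℕ :=
  Nat.card (G.induce U).ConnectedComponent

/-- The maximum over all vertex sets `U` of `|U|` plus the number of components induced on `U`;
this is the dimension of the binomial edge ring. -/
noncomputable def SimpleGraph.maxSizeAddComponents {V : Type*} (G : SimpleGraph V) : ℕ :=
  ⨆ U : Set V, (U.ncard + G.numComponents U)

section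

variable {V : Type*} (G : SimpleGraph V)

theorem SimpleGraph.le_maxSizeAddComponents [Finite V] (U : Set V) :
    U.ncard + G.numComponents U ≤ G.maxSizeAddComponents :=
  le_ciSup (f := fun U : Set V => U.ncard + G.numComponents U) (Set.finite_range _).bddAbove U

theorem SimpleGraph.exists_eq_maxSizeAddComponents [Finite V] :
    ∃ U : Set V, U.ncard + G.numComponents U = G.maxSizeAddComponents :=
  exists_eq_ciSup_of_finite (f := fun U : Set V => U.ncard + G.numComponents U)

theorem SimpleGraph.maxSizeAddComponents_eq [Finite V] {d : ℕ}
    (hle : ∀ U : Set V, U.ncard + G.numComponents U ≤ d)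
    (hex : ∃ U : Set V, U.ncard + G.numComponents U = d) : G.maxSizeAddComponents = d := by
  obtain ⟨U, hU⟩ := hex
  exact le_antisymm (ciSup_le hle) (hU ▸ G.le_maxSizeAddComponents U)

theorem SimpleGraph.apply_eq_of_reachable {α : Type*} {f : V → α}
    (hf : ∀ v w, G.Adj v w → f v = f w) {v w : V} (h : G.Reachable v w) : f v = f w := by
  obtain ⟨p⟩ := h
  induction p with
  | nil => rfl
  | cons h _ ih => exact (hf _ _ h).trans ih

/-- A function on vertices that is constant along edges, as a function on components. -/
def SimpleGraph.liftOfAdj {α : Type*} (f : V → α) (hf : ∀ v w, G.Adj v w → f v = f w) :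
    G.ConnectedComponent → α :=
  Quot.lift f fun _ _ h => G.apply_eq_of_reachable hf h

variable (K : Type*) [Field K]

open MvPolynomial

theorem binomialEdgeIdeal_le_ker {A : Type*} [CommRing A] [Algebra K A] (f : Fin 2 × V → A)
    (hf : ∀ i j, G.Adj i j → f (0, i) * f (1, j) = f (0, j) * f (1, i)) :
    binomialEdgeIdeal K G ≤ RingHom.ker (aeval f : EdgeRing K V →ₐ[K] A) := by
  refine Ideal.span_le.2 ?_
  rintro _ ⟨i, j, hij, rfl⟩
  simp [RingHom.mem_ker, hf i j hij]

theorem exists_card_le_height_add [Finite V] (P : Ideal (EdgeRing K V)) [P.IsPrime]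
    (hP : binomialEdgeIdeal K G ≤ P) :
    ∃ U : Set V, ((2 * Nat.card V : ℕ) : ℕ∞) ≤ P.height + (U.ncard + G.numComponents U : ℕ) := by
  classical
  let L := FractionRing (EdgeRing K V ⧸ P)
  let φ : EdgeRing K V →ₐ[K] L :=
    (IsScalarTower.toAlgHom K (EdgeRing K V ⧸ P) L).comp (Ideal.Quotient.mkₐ K P)
  let f : Fin 2 × V → L := fun p => φ (X p)
  have hφ : φ = aeval f := by
    ext p
    simp [f]
  have hker : RingHom.ker (aeval f : EdgeRing K V →ₐ[K] L) = P := by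
    rw [← hφ]
    ext p
    simp [φ, L, RingHom.mem_ker, Ideal.Quotient.eq_zero_iff_mem]
  have hadj : ∀ i j, G.Adj i j → f (0, i) * f (1, j) = f (0, j) * f (1, i) := by
    intro i j hij
    have : X (0, i) * X (1, j) - X (0, j) * X (1, i) ∈
        RingHom.ker (aeval f : EdgeRing K V →ₐ[K] L) := by
      rw [hker]
      exact hP (Ideal.subset_span ⟨i, j, hij, rfl⟩)
    simpa [RingHom.mem_ker, sub_eq_zero] using this
  let U : Set V := {v | f (0, v) ≠ 0 ∨ f (1, v) ≠ 0}
  refine ⟨U, ?_⟩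
  let C := (G.induce U).ConnectedComponent
  -- Adjacent vertices of U have y-values that vanish together. Where they vanish the ratio is
  -- infinite, the quotient takes the default value 0, and `scale` records x instead.
  let slope : C → L := (G.induce U).liftOfAdj (fun v => f (0, v.1) / f (1, v.1)) (by
    rintro ⟨v, hv⟩ ⟨w, hw⟩ h
    have h' := hadj v w h
    simp only [U, Set.mem_ofPred_eq] at hv hw
    by_cases h1 : f (1, v) = 0
    · have : f (1, w) = 0 := by
        rw [h1, mul_zero] at h'
        exact (mul_eq_zero.1 h').resolve_left (hv.resolve_right (not_not.2 h1))
      simp [h1, this]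
    · have h2 : f (1, w) ≠ 0 := by
        intro h2
        rw [h2, mul_zero] at h'
        exact mul_ne_zero (hw.resolve_right (not_not.2 h2)) h1 h'.symm
      rw [div_eq_div_iff h1 h2, h'])
  let scale : U → L := fun v => if f (1, v.1) = 0 then f (0, v.1) else f (1, v.1)
  let g : Fin 2 × V → MvPolynomial (C ⊕ U) K := fun p =>
    if h : p.2 ∈ U then
      if f (1, p.2) = 0 then (if p.1 = 0 then X (Sum.inr ⟨p.2, h⟩) else 0)
      else if p.1 = 0 then
        X (Sum.inl ((G.induce U).connectedComponentMk ⟨p.2, h⟩)) * X (Sum.inr ⟨p.2, h⟩)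
      else X (Sum.inr ⟨p.2, h⟩)
    else 0
  have hg : ∀ p, aeval (Sum.elim slope scale) (g p) = f p := by
    rintro ⟨k, v⟩
    by_cases hv : v ∈ U
    · have hs : slope ((G.induce U).connectedComponentMk ⟨v, hv⟩) = f (0, v) / f (1, v) := rfl
      by_cases h1 : f (1, v) = 0
      · fin_cases k <;> simp [g, hv, h1, scale]
      · fin_cases k <;> simp [g, hv, h1, scale, hs, div_mul_cancel₀]
    · have hv' := hv
      simp only [U, Set.mem_ofPred_eq, not_or, not_not] at hv'
      fin_cases k <;> simp [g, hv, hv']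
  obtain ⟨m, b, hb, hle⟩ := exists_algebraicIndependent_card_le_height_add (K := K) f
  -- Independence of the values lifts to the parametrising polynomials, so m is at most the number
  -- of parameters.
  have hgb : AlgebraicIndependent K (g ∘ b) := by
    refine AlgebraicIndependent.of_comp (aeval (Sum.elim slope scale)) ?_
    convert hb using 1
    ext i
    simp [hg]
  have hm : m ≤ U.ncard + G.numComponents U := by
    have := hgb.lift_cardinalMk_le_trdeg
    rw [MvPolynomial.trdeg_of_isDomain, ← Nat.cast_card (α := C ⊕ U)] at this
    simp only [Cardinal.mk_fin, Cardinal.lift_natCast, Nat.cast_le, Nat.card_sum] at this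
    rw [← Nat.card_coe_set_eq, add_comm]
    exact this
  rw [hker] at hle
  refine le_trans ?_ (hle.trans (by gcongr))
  simp

/-- Values of the component slopes and vertex scales, where those in `W` are specialised
to `0` and `1`, respectively. -/
noncomputable def specialisedVar {C U : Type*} (W : Set (C ⊕ U)) (t : C ⊕ U) :
    MvPolynomial (C ⊕ U) K :=
  open scoped Classical in if t ∈ W then t.elim (fun _ => 0) (fun _ => 1) else X t

/-- The parametrisation `x_v ↦ λ_c μ_v`, `y_v ↦ μ_v` for `v ∈ U` in the component `c`. -/
noncomputable def componentParam (U : Set V) (W : Set ((G.induce U).ConnectedComponent ⊕ U))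
    (p : Fin 2 × V) : MvPolynomial ((G.induce U).ConnectedComponent ⊕ U) K :=
  open scoped Classical in
  if h : p.2 ∈ U then
    (if p.1 = 0 then
      specialisedVar K W (Sum.inl ((G.induce U).connectedComponentMk ⟨p.2, h⟩)) else 1)
      * specialisedVar K W (Sum.inr ⟨p.2, h⟩)
  else 0

theorem specialisedVar_of_mem {C U : Type*} {W : Set (C ⊕ U)} {t : C ⊕ U} (h : t ∈ W) :
    specialisedVar K W t = t.elim (fun _ => 0) (fun _ => 1) := by
  simp [specialisedVar, h]

theorem specialisedVar_of_notMem {C U : Type*} {W : Set (C ⊕ U)} {t : C ⊕ U} (h : t ∉ W) :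
    specialisedVar K W t = X t := by
  simp [specialisedVar, h]

theorem specialisedVar_inr_ne_zero {C U : Type*} (W : Set (C ⊕ U)) (u : U) :
    specialisedVar K W (Sum.inr u) ≠ 0 := by
  by_cases h : Sum.inr u ∈ W
  · simp [specialisedVar_of_mem K h]
  · simp [specialisedVar_of_notMem K h]

theorem bind₁_specialisedVar {C U : Type*} {W W' : Set (C ⊕ U)} (h : W ⊆ W') (t : C ⊕ U) :
    bind₁ (specialisedVar K W') (specialisedVar K W t) = specialisedVar K W' t := by
  by_cases ht : t ∈ W
  · rw [specialisedVar_of_mem K ht, specialisedVar_of_mem K (h ht)]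
    cases t <;> simp
  · rw [specialisedVar_of_notMem K ht, bind₁_X_right]

/-- The prime ideal of relations of `componentParam`. -/
noncomputable def componentPrime (U : Set V) (W : Set ((G.induce U).ConnectedComponent ⊕ U)) :
    PrimeSpectrum (EdgeRing K V) :=
  ⟨RingHom.ker (aeval (componentParam G K U W) : EdgeRing K V →ₐ[K] _), RingHom.ker_isPrime _⟩

theorem binomialEdgeIdeal_le_componentPrime (U : Set V)
    (W : Set ((G.induce U).ConnectedComponent ⊕ U)) :
    binomialEdgeIdeal K G ≤ (componentPrime G K U W).asIdeal := by
  refine binomialEdgeIdeal_le_ker G K _ fun i j hij => ?_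
  by_cases hi : i ∈ U
  · by_cases hj : j ∈ U
    · have : (G.induce U).connectedComponentMk ⟨i, hi⟩ =
          (G.induce U).connectedComponentMk ⟨j, hj⟩ :=
        SimpleGraph.ConnectedComponent.connectedComponentMk_eq_of_adj hij
      simp only [componentParam, hi, hj, dif_pos, if_true, this]
      simp
      ring
    · simp [componentParam, hj]
  · simp [componentParam, hi]

/-- Specialising more parameters factors through specialising fewer, which gives the inclusion. It
is strict because a newly specialised slope puts some x_v in the kernel, and a newly specialised
scale puts y_v - 1 there. -/
theorem componentPrime_strictMono (U : Set V) : StrictMono (componentPrime G K U) := by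
  intro W W' hlt
  have hcomp : ∀ p : EdgeRing K V, aeval (componentParam G K U W') p =
      aeval (specialisedVar K W') (aeval (componentParam G K U W) p) := by
    intro p
    rw [← AlgHom.comp_apply]
    congr 1
    ext ⟨k, v⟩ : 1
    by_cases hv : v ∈ U <;>
    fin_cases k <;>
    simp [componentParam, hv, bind₁_specialisedVar K hlt.le]
  refine lt_of_le_not_ge ?_ ?_
  · intro p hp
    have hp' : aeval (componentParam G K U W) p = 0 := hp
    change aeval (componentParam G K U W') p = 0
    rw [hcomp, hp', map_zero]
  · obtain ⟨t, ht', ht⟩ := Set.exists_of_ssubset hlt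
    intro hle
    cases t with
    | inl c =>
      induction c using SimpleGraph.ConnectedComponent.ind with
      | h v =>
        have h1 : (X (0, v.1) : EdgeRing K V) ∈ (componentPrime G K U W').asIdeal := by
          change aeval _ _ = 0
          simp [componentParam, specialisedVar_of_mem K ht']
        have h2 : aeval (componentParam G K U W) (X (0, v.1) : EdgeRing K V) = 0 := hle h1
        simp [componentParam, specialisedVar_of_notMem K ht, specialisedVar_inr_ne_zero] at h2
    | inr v =>
      have h1 : (X (1, v.1) - 1 : EdgeRing K V) ∈ (componentPrime G K U W').asIdeal := by
        change aeval _ _ = 0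
        simp [componentParam, specialisedVar_of_mem K ht']
      have h2 : aeval (componentParam G K U W) (X (1, v.1) - 1 : EdgeRing K V) = 0 := hle h1
      -- At the origin the relation X - 1 = 0 would read -1 = 0.
      have h3 := congrArg (MvPolynomial.eval 0) h2
      simp [componentParam, specialisedVar_of_notMem K ht] at h3

theorem exists_ltSeries_binomialEdgeIdeal_le [Finite V] (U : Set V) :
    ∃ s : LTSeries (PrimeSpectrum (EdgeRing K V)), binomialEdgeIdeal K G ≤ s.head.asIdeal ∧
      s.length = U.ncard + G.numComponents U := by
  let e := Finite.equivFin ((G.induce U).ConnectedComponent ⊕ U)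
  let W : Fin (Nat.card ((G.induce U).ConnectedComponent ⊕ U) + 1) → Set _ :=
    fun k => {t | (e t).castSucc < k}
  have hW : StrictMono W := by
    refine Fin.strictMono_iff_lt_succ.2 fun k => ?_
    refine Set.ssubset_iff_of_subset (fun t ht => lt_trans ht k.castSucc_lt_succ) |>.2 ?_
    exact ⟨e.symm k, show (e (e.symm k)).castSucc < k.succ by simp,
      show ¬ (e (e.symm k)).castSucc < k.castSucc by simp⟩
  refine ⟨LTSeries.mk _ _ ((componentPrime_strictMono G K U).comp hW),
    binomialEdgeIdeal_le_componentPrime G K U _, ?_⟩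
  simp only [LTSeries.mk, Nat.card_sum, SimpleGraph.numComponents, Nat.card_coe_set_eq]
  rw [add_comm]

/-- The height of the binomial edge ideal and the dimension of its quotient ring. -/
theorem binomialEdgeIdeal_height_add_eq_and_dim_eq [Finite V] :
    (binomialEdgeIdeal K G).height + G.maxSizeAddComponents = (2 * Nat.card V : ℕ) ∧
      ringKrullDim (EdgeRing K V ⧸ binomialEdgeIdeal K G) = G.maxSizeAddComponents := by
  obtain ⟨U, hU⟩ := G.exists_eq_maxSizeAddComponents
  obtain ⟨s, hs, hlen⟩ := exists_ltSeries_binomialEdgeIdeal_le G K U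
  refine Ideal.height_add_eq_and_ringKrullDim_quotient_eq ?_ ?_ s hs (hlen.trans hU)
  · rw [MvPolynomial.ringKrullDim_of_isNoetherianRing, ringKrullDim_eq_zero_of_field]
    simp
  · intro P _ hle
    obtain ⟨U, hU⟩ := exists_card_le_height_add G K P hle
    refine hU.trans ?_
    gcongr
    exact G.le_maxSizeAddComponents U

end

/-! ### Additivity over connected components. -/

namespace SimpleGraph

variable {V W : Type*} (G : SimpleGraph V) (H : SimpleGraph W)

theorem card_connectedComponent_congr {G : SimpleGraph V} {H : SimpleGraph W} (e : G ≃g H) :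
    Nat.card G.ConnectedComponent = Nat.card H.ConnectedComponent :=
  Nat.card_congr e.connectedComponentEquiv

theorem numComponents_image {G : SimpleGraph V} {H : SimpleGraph W} (φ : G ↪g H) (U : Set V) :
    H.numComponents (φ '' U) = G.numComponents U :=
  (card_connectedComponent_congr
    ⟨Equiv.Set.image φ U φ.injective, by rintro ⟨a, ha⟩ ⟨b, hb⟩; simp⟩).symm

theorem numComponents_pos [Finite V] {U : Set V} (hU : U.Nonempty) : 0 < G.numComponents U := by
  have : Nonempty (G.induce U).ConnectedComponent :=
    ⟨(G.induce U).connectedComponentMk ⟨hU.some, hU.some_mem⟩⟩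
  exact Nat.card_pos

theorem numComponents_empty : G.numComponents ∅ = 0 := by
  have : IsEmpty (G.induce (∅ : Set V)).ConnectedComponent :=
    ⟨fun c => c.ind fun v => v.2.elim⟩
  exact Nat.card_of_isEmpty

theorem numComponents_eq_one {U : Set V} (hU : U.Nonempty) (h : (G.induce U).Preconnected) :
    G.numComponents U = 1 := by
  have := h.subsingleton_connectedComponent
  have : Nonempty (G.induce U).ConnectedComponent :=
    ⟨(G.induce U).connectedComponentMk ⟨hU.some, hU.some_mem⟩⟩
  exact Nat.card_eq_one_iff_unique.2 ⟨‹_›, ‹_›⟩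

theorem sigma_mk_fiber_eq {ι : Type*} (p : V → ι) {i : ι} (w : V) (hi : p w = i) :
    (⟨p w, (G.induce {v | p v = p w}).connectedComponentMk ⟨w, rfl⟩⟩ :
      Σ i, (G.induce {v | p v = i}).ConnectedComponent) =
      ⟨i, (G.induce {v | p v = i}).connectedComponentMk ⟨w, hi⟩⟩ := by
  subst hi
  rfl

/-- If `p` is constant along edges, the components of `G` are those of the fibres of `p`. -/
noncomputable def connectedComponentEquivSigma {ι : Type*} (p : V → ι)
    (hp : ∀ v w, G.Adj v w → p v = p w) :
    G.ConnectedComponent ≃ Σ i, (G.induce {v | p v = i}).ConnectedComponent where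
  toFun := G.liftOfAdj
    (fun v => ⟨p v, (G.induce {w | p w = p v}).connectedComponentMk ⟨v, rfl⟩⟩) (by
      intro v w h
      rw [sigma_mk_fiber_eq G p w (hp v w h).symm, Sigma.mk.injEq]
      refine ⟨rfl, heq_of_eq ?_⟩
      exact ConnectedComponent.connectedComponentMk_eq_of_adj h)
  invFun x := x.2.map (Embedding.induce _).toHom
  left_inv c := by
    induction c using ConnectedComponent.ind with
    | h v => rfl
  right_inv := by
    rintro ⟨i, c⟩
    induction c using ConnectedComponent.ind with
    | h v => exact sigma_mk_fiber_eq G p v.1 v.2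

theorem numComponents_eq_sum [Finite V] [Fintype G.ConnectedComponent] (U : Set V) :
    G.numComponents U =
      ∑ c : G.ConnectedComponent, c.toSimpleGraph.numComponents (Subtype.val ⁻¹' U) := by
  rw [numComponents, Nat.card_congr ((G.induce U).connectedComponentEquivSigma
    (fun v => G.connectedComponentMk v.1)
    (fun v w h => ConnectedComponent.connectedComponentMk_eq_of_adj h)), Nat.card_sigma]
  refine Finset.sum_congr rfl fun c _ => card_connectedComponent_congr ⟨⟨fun v => ⟨⟨v.1.1, v.2⟩,
    v.1.2⟩, fun v => ⟨⟨v.1.1, v.2⟩, v.1.2⟩, fun _ => rfl, fun _ => rfl⟩, Iff.rfl⟩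

theorem ncard_eq_sum [Finite V] [Fintype G.ConnectedComponent] (U : Set V) :
    U.ncard = ∑ c : G.ConnectedComponent, (Subtype.val ⁻¹' U : Set c).ncard := by
  simp only [← Nat.card_coe_set_eq]
  rw [← Nat.card_sigma]
  exact Nat.card_congr ⟨fun v => ⟨G.connectedComponentMk v.1, ⟨⟨v.1, rfl⟩, v.2⟩⟩,
    fun x => ⟨x.2.1.1, x.2.2⟩, fun _ => rfl, by rintro ⟨c, ⟨v, rfl⟩, h⟩; rfl⟩

theorem maxSizeAddComponents_eq_sum [Finite V] [Fintype G.ConnectedComponent] :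
    G.maxSizeAddComponents =
      ∑ c : G.ConnectedComponent, c.toSimpleGraph.maxSizeAddComponents := by
  refine G.maxSizeAddComponents_eq (fun U => ?_) ?_
  · rw [G.ncard_eq_sum, G.numComponents_eq_sum, ← Finset.sum_add_distrib]
    exact Finset.sum_le_sum fun c _ => c.toSimpleGraph.le_maxSizeAddComponents _
  · choose U hU using fun c : G.ConnectedComponent =>
      c.toSimpleGraph.exists_eq_maxSizeAddComponents
    -- Optimal sets of the components are glued, since they can be chosen independently.
    let U' : Set V := {v | ⟨v, rfl⟩ ∈ U (G.connectedComponentMk v)}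
    have hU' : ∀ c : G.ConnectedComponent, (Subtype.val ⁻¹' U' : Set c) = U c := by
      intro c
      ext ⟨v, hv⟩
      obtain rfl : G.connectedComponentMk v = c := hv
      rfl
    refine ⟨U', ?_⟩
    rw [G.ncard_eq_sum, G.numComponents_eq_sum, ← Finset.sum_add_distrib]
    exact Finset.sum_congr rfl fun c _ => by rw [hU', hU]

theorem maxSizeAddComponents_le_two_mul [Finite V] :
    G.maxSizeAddComponents ≤ 2 * Nat.card V := by
  obtain ⟨U, hU⟩ := G.exists_eq_maxSizeAddComponents
  have h1 : G.numComponents U ≤ U.ncard := by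
    rw [← Nat.card_coe_set_eq]
    exact Nat.card_le_card_of_surjective _ Quot.mk_surjective
  have h2 : U.ncard ≤ Nat.card V := Set.ncard_le_card U
  omega

end SimpleGraph

/-! ### Sets with the cut point property. -/

section CutPoints

variable {V : Type*} (G : SimpleGraph V)

/-- Deleting i from the graph on Tᶜ ∪ {i} leaves the graph on Tᶜ; the empty set qualifies vacuously.
-/
theorem mem_cutPointSets_iff {T : Set V} :
    T ∈ cutPointSets G ↔ ∀ i ∈ T, G.numComponents (Tᶜ ∪ {i}) < G.numComponents Tᶜ := by
  have key : T ∈ cutPointSets G ↔ HasCutPointProperty G T := by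
    constructor
    · rintro (rfl | h)
      · exact fun i hi => hi.elim
      · exact h
    · exact Or.inr
  rw [key]
  refine forall₂_congr fun i hi => ?_
  have : Nat.card ((G.induce (Tᶜ ∪ {i})).induce
      {w | w ≠ ⟨i, Or.inr rfl⟩}).ConnectedComponent = G.numComponents Tᶜ := by
    refine SimpleGraph.card_connectedComponent_congr ⟨⟨fun w => ⟨w.1.1, ?_⟩,
      fun w => ⟨⟨w.1, Or.inl w.2⟩, ?_⟩, fun _ => rfl, fun _ => rfl⟩, Iff.rfl⟩
    · exact w.1.2.resolve_right fun h => w.2 (Subtype.ext h)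
    · exact fun h => w.2 (by rw [congrArg Subtype.val h]; exact hi)
  rw [IsCutPoint, this]
  rfl

theorem compl_nonempty_of_mem_cutPointSets [Finite V] [Nonempty V] {T : Set V}
    (hT : T ∈ cutPointSets G) : Tᶜ.Nonempty := by
  by_contra h
  rw [Set.not_nonempty_iff_eq_empty] at h
  obtain ⟨v⟩ := ‹Nonempty V›
  have hv : v ∈ T := by
    by_contra hv
    exact h.subset (show v ∈ Tᶜ from hv)
  have := (mem_cutPointSets_iff G).1 hT v hv
  rw [h, SimpleGraph.numComponents_empty] at this
  omega

theorem mem_cutPointSets_iff_forall_component [Finite V] {T : Set V} :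
    T ∈ cutPointSets G ↔ ∀ c : G.ConnectedComponent,
      (Subtype.val ⁻¹' T : Set c) ∈ cutPointSets c.toSimpleGraph := by
  classical
  have := Fintype.ofFinite G.ConnectedComponent
  -- Restoring i changes only the summand of the component containing i.
  have key : ∀ (c : G.ConnectedComponent) (i : c),
      G.numComponents (Tᶜ ∪ {i.1}) < G.numComponents Tᶜ ↔
      c.toSimpleGraph.numComponents ((Subtype.val ⁻¹' T : Set c)ᶜ ∪ {i}) <
        c.toSimpleGraph.numComponents (Subtype.val ⁻¹' T : Set c)ᶜ := by
    intro c i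
    rw [G.numComponents_eq_sum, G.numComponents_eq_sum,
      ← Finset.add_sum_erase _ _ (Finset.mem_univ c),
      ← Finset.add_sum_erase Finset.univ (fun c : G.ConnectedComponent =>
        c.toSimpleGraph.numComponents (Subtype.val ⁻¹' Tᶜ)) (Finset.mem_univ c)]
    have h1 : (Subtype.val ⁻¹' (Tᶜ ∪ {i.1}) : Set c) = (Subtype.val ⁻¹' T : Set c)ᶜ ∪ {i} := by
      ext v
      exact or_congr Iff.rfl Subtype.ext_iff.symm
    have h2 : ∀ d ∈ Finset.univ.erase c,
        d.toSimpleGraph.numComponents (Subtype.val ⁻¹' (Tᶜ ∪ {i.1}) : Set d) =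
        d.toSimpleGraph.numComponents (Subtype.val ⁻¹' Tᶜ : Set d) := by
      intro d hd
      congr 1
      ext v
      have : v.1 ≠ i.1 := fun h => (Finset.mem_erase.1 hd).1 (v.2.symm.trans (h ▸ i.2))
      exact ⟨fun h => h.resolve_right this, Or.inl⟩
    rw [Finset.sum_congr rfl h2, h1, Set.preimage_compl]
    exact Nat.add_lt_add_iff_right
  rw [mem_cutPointSets_iff]
  constructor
  · exact fun h c => (mem_cutPointSets_iff _).2 fun i hi => (key c i).1 (h i hi)
  · exact fun h i hi => (key (G.connectedComponentMk i) ⟨i, rfl⟩).2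
      ((mem_cutPointSets_iff _).1 (h _) ⟨i, rfl⟩ hi)

theorem iJoinCollections_liftCollection_cutPointSets [Finite V] {ι : Type*}
    (e : ι ≃ G.ConnectedComponent) :
    (iJoinCollections fun i => liftCollection (e i) (cutPointSets (e i).toSimpleGraph)) =
      cutPointSets G := by
  ext T
  rw [mem_cutPointSets_iff_forall_component]
  constructor
  · rintro ⟨A, hA, rfl⟩ c
    choose B hB hAB using hA
    obtain ⟨i, rfl⟩ := e.surjective c
    convert hB i
    ext v
    simp only [Set.mem_preimage, Set.mem_iUnion]
    constructor
    · rintro ⟨j, hj⟩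
      rw [hAB] at hj
      obtain ⟨w, hw, hwv⟩ := hj
      obtain rfl : j = i := e.injective (w.2.symm.trans (hwv ▸ v.2))
      rwa [← Subtype.ext hwv]
    · exact fun hv => ⟨i, hAB i ▸ ⟨v, hv, rfl⟩⟩
  · refine fun h => ⟨fun i => Subtype.val '' (Subtype.val ⁻¹' T : Set (e i)),
      fun i => ⟨_, h (e i), rfl⟩, ?_⟩
    ext v
    simp only [Set.mem_iUnion]
    constructor
    · intro hv
      obtain ⟨i, hi⟩ := e.surjective (G.connectedComponentMk v)
      exact ⟨i, ⟨v, hi.symm⟩, hv, rfl⟩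
    · rintro ⟨i, w, hw, rfl⟩
      exact hw

/-- T cannot exhaust any component of G, so each one contributes at least one component to the
complement. -/
theorem two_le_numComponents_compl [Finite V] {T : Set V} (hT : T ∈ cutPointSets G)
    (hG : 2 ≤ Nat.card G.ConnectedComponent) : 2 ≤ G.numComponents Tᶜ := by
  have := Fintype.ofFinite G.ConnectedComponent
  rw [G.numComponents_eq_sum]
  refine hG.trans ?_
  rw [Nat.card_eq_fintype_card, ← Finset.card_univ, Finset.card_eq_sum_ones]
  refine Finset.sum_le_sum fun c _ => ?_
  have : Nonempty c := c.nonempty_supp.to_subtype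
  exact SimpleGraph.numComponents_pos _ (compl_nonempty_of_mem_cutPointSets _
    ((mem_cutPointSets_iff_forall_component G).1 hT c))

end CutPoints

/-! ### Cut sets and dimension of a join. -/

section

variable {V W : Type*}

/-- Stated for an embedding so that it serves both sides of the join. The complement of the big set
is a copy of Aᶜ; a vertex outside the range merges its components, at least two in number, into one.
-/
theorem image_union_compl_range_mem_cutPointSets_iff [Finite V] {G : SimpleGraph V}
    {J : SimpleGraph W} (φ : G ↪g J) (hG : 2 ≤ Nat.card G.ConnectedComponent)
    (hJ : ∀ U : Set V, U.Nonempty → ∀ i ∉ Set.range φ, J.numComponents (φ '' U ∪ {i}) = 1)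
    {A : Set V} : φ '' A ∪ (Set.range φ)ᶜ ∈ cutPointSets J ↔ A ∈ cutPointSets G := by
  have hcompl : (φ '' A ∪ (Set.range φ)ᶜ)ᶜ = φ '' Aᶜ := by
    rw [Set.compl_union, compl_compl, Set.image_compl_eq_range_sdiff_image φ.injective]
    ext
    simp [and_comm]
  have hmem : ∀ a, φ '' Aᶜ ∪ {φ a} = φ '' (Aᶜ ∪ {a}) := fun a => by
    rw [Set.image_union, Set.image_singleton]
  constructor
  · rw [mem_cutPointSets_iff, mem_cutPointSets_iff, hcompl]
    intro h a ha
    simpa [hmem, SimpleGraph.numComponents_image] using h (φ a) (Or.inl ⟨a, ha, rfl⟩)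
  · intro hA
    have h2 := two_le_numComponents_compl G hA hG
    rw [mem_cutPointSets_iff] at hA ⊢
    rw [hcompl]
    rintro _ (⟨a, ha, rfl⟩ | hi)
    · rw [hmem, SimpleGraph.numComponents_image, SimpleGraph.numComponents_image]
      exact hA a ha
    · have hne : Aᶜ.Nonempty := by
        by_contra h
        rw [Set.not_nonempty_iff_eq_empty] at h
        rw [h, SimpleGraph.numComponents_empty] at h2
        omega
      rw [hJ _ hne _ hi, SimpleGraph.numComponents_image]
      omega

variable (G : SimpleGraph V) (H : SimpleGraph W)

/-- The first graph as an induced subgraph of the join. -/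
def graphJoinInl : G ↪g graphJoin G H := ⟨⟨Sum.inl, Sum.inl_injective⟩, by simp [graphJoin]⟩

/-- The second graph as an induced subgraph of the join. -/
def graphJoinInr : H ↪g graphJoin G H := ⟨⟨Sum.inr, Sum.inr_injective⟩, by simp [graphJoin]⟩

/-- Every vertex of U reaches a, directly or through b. -/
theorem graphJoin_numComponents_eq_one {U : Set (V ⊕ W)} {a : V} {b : W}
    (ha : Sum.inl a ∈ U) (hb : Sum.inr b ∈ U) : (graphJoin G H).numComponents U = 1 := by
  refine SimpleGraph.numComponents_eq_one _ ⟨_, ha⟩ ?_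
  have h : ∀ v w (hv : Sum.inl v ∈ U) (hw : Sum.inr w ∈ U),
      ((graphJoin G H).induce U).Reachable ⟨Sum.inl v, hv⟩ ⟨Sum.inr w, hw⟩ := fun v w hv hw =>
    SimpleGraph.Adj.reachable (by simp [graphJoin])
  have h' : ∀ x, ((graphJoin G H).induce U).Reachable x ⟨Sum.inl a, ha⟩ := by
    rintro ⟨v | w, hx⟩
    · exact (h v b hx hb).trans (h a b ha hb).symm
    · exact (h a w ha hx).symm
  exact fun x y => (h' x).trans (h' y).symm

theorem sum_set_cases (U : Set (V ⊕ W)) :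
    (∃ A, U = Sum.inl '' A) ∨ (∃ B, U = Sum.inr '' B) ∨
      ∃ a b, Sum.inl a ∈ U ∧ Sum.inr b ∈ U := by
  by_cases hb : ∃ b, Sum.inr b ∈ U
  · by_cases ha : ∃ a, Sum.inl a ∈ U
    · obtain ⟨a, ha⟩ := ha
      obtain ⟨b, hb⟩ := hb
      exact Or.inr (Or.inr ⟨a, b, ha, hb⟩)
    · refine Or.inr (Or.inl ⟨Sum.inr ⁻¹' U, ?_⟩)
      ext (v | w)
      · simpa using fun h => ha ⟨v, h⟩
      · simp
  · refine Or.inl ⟨Sum.inl ⁻¹' U, ?_⟩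
    ext (v | w)
    · simp
    · simpa using fun h => hb ⟨w, h⟩

theorem mem_cutPointSets_graphJoin_iff [Finite V] [Finite W]
    (hG : 2 ≤ Nat.card G.ConnectedComponent) (hH : 2 ≤ Nat.card H.ConnectedComponent)
    {T : Set (V ⊕ W)} : T ∈ cutPointSets (graphJoin G H) ↔
      T = ∅ ∨ (∃ A ∈ cutPointSets G, T = Sum.inl '' A ∪ Set.range Sum.inr) ∨
        ∃ B ∈ cutPointSets H, T = Sum.inr '' B ∪ Set.range Sum.inl := by
  have hl : ∀ A, Sum.inl '' A ∪ Set.range Sum.inr ∈ cutPointSets (graphJoin G H) ↔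
      A ∈ cutPointSets G := by
    intro A
    rw [← image_union_compl_range_mem_cutPointSets_iff (graphJoinInl G H) hG]
    · rw [← Set.compl_range_inl]
      rfl
    · rintro U ⟨a, ha⟩ (i | i) hi
      · exact (hi ⟨i, rfl⟩).elim
      · exact graphJoin_numComponents_eq_one G H (Or.inl ⟨a, ha, rfl⟩) (Or.inr rfl)
  have hr : ∀ B, Sum.inr '' B ∪ Set.range Sum.inl ∈ cutPointSets (graphJoin G H) ↔
      B ∈ cutPointSets H := by
    intro B
    rw [← image_union_compl_range_mem_cutPointSets_iff (graphJoinInr G H) hH]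
    · rw [← Set.compl_range_inr]
      rfl
    · rintro U ⟨b, hb⟩ (i | i) hi
      · exact graphJoin_numComponents_eq_one G H (Or.inr rfl) (Or.inl ⟨b, hb, rfl⟩)
      · exact (hi ⟨i, rfl⟩).elim
  constructor
  · intro hT
    rcases sum_set_cases Tᶜ with ⟨A, hA⟩ | ⟨B, hB⟩ | ⟨a, b, ha, hb⟩
    · have : T = Sum.inl '' Aᶜ ∪ Set.range Sum.inr := by
        rw [← compl_compl T, hA]
        ext (v | w) <;> simp
      exact Or.inr (Or.inl ⟨Aᶜ, (hl _).1 (this ▸ hT), this⟩)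
    · have : T = Sum.inr '' Bᶜ ∪ Set.range Sum.inl := by
        rw [← compl_compl T, hB]
        ext (v | w) <;> simp
      exact Or.inr (Or.inr ⟨Bᶜ, (hr _).1 (this ▸ hT), this⟩)
    -- The complement is already connected, so restoring a vertex cannot lower the count.
    · refine Or.inl (Set.eq_empty_iff_forall_notMem.2 fun i hi => ?_)
      have h := (mem_cutPointSets_iff _).1 hT i hi
      rw [graphJoin_numComponents_eq_one G H ha hb,
        graphJoin_numComponents_eq_one G H (Or.inl ha) (Or.inl hb)] at h
      omega
  · rintro (rfl | ⟨A, hA, rfl⟩ | ⟨B, hB, rfl⟩)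
    · exact Or.inl rfl
    · exact (hl A).2 hA
    · exact (hr B).2 hB

theorem maxSizeAddComponents_graphJoin [Finite V] [Finite W] [Nonempty V] [Nonempty W] :
    (graphJoin G H).maxSizeAddComponents =
      max G.maxSizeAddComponents (max H.maxSizeAddComponents (Nat.card V + Nat.card W + 1)) := by
  have hl : ∀ A : Set V, (Sum.inl '' A : Set (V ⊕ W)).ncard +
      (graphJoin G H).numComponents (Sum.inl '' A) = A.ncard + G.numComponents A := fun A => by
    rw [Set.ncard_image_of_injective _ Sum.inl_injective,
      ← SimpleGraph.numComponents_image (graphJoinInl G H) A]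
    rfl
  have hr : ∀ B : Set W, (Sum.inr '' B : Set (V ⊕ W)).ncard +
      (graphJoin G H).numComponents (Sum.inr '' B) = B.ncard + H.numComponents B := fun B => by
    rw [Set.ncard_image_of_injective _ Sum.inr_injective,
      ← SimpleGraph.numComponents_image (graphJoinInr G H) B]
    rfl
  apply le_antisymm
  · obtain ⟨U, hU⟩ := (graphJoin G H).exists_eq_maxSizeAddComponents
    rw [← hU]
    rcases sum_set_cases U with ⟨A, rfl⟩ | ⟨B, rfl⟩ | ⟨a, b, ha, hb⟩
    · rw [hl]
      exact (G.le_maxSizeAddComponents A).trans (le_max_left _ _)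
    · rw [hr]
      exact (H.le_maxSizeAddComponents B).trans (le_max_of_le_right (le_max_left _ _))
    · rw [graphJoin_numComponents_eq_one G H ha hb, ← Nat.card_sum]
      exact le_max_of_le_right (le_max_of_le_right (by gcongr; exact Set.ncard_le_card U))
  · refine max_le ?_ (max_le ?_ ?_)
    · obtain ⟨A, hA⟩ := G.exists_eq_maxSizeAddComponents
      exact hA ▸ hl A ▸ (graphJoin G H).le_maxSizeAddComponents _
    · obtain ⟨B, hB⟩ := H.exists_eq_maxSizeAddComponents
      exact hB ▸ hr B ▸ (graphJoin G H).le_maxSizeAddComponents _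
    -- The whole vertex set is connected and attains the third term.
    · have := (graphJoin G H).le_maxSizeAddComponents Set.univ
      rwa [graphJoin_numComponents_eq_one G H (a := Classical.arbitrary V)
        (b := Classical.arbitrary W) (Set.mem_univ _) (Set.mem_univ _), Set.ncard_univ, Nat.card_sum] at this

/-- The subtraction is not truncated, because c(U) ≤ |U| gives d(G) ≤ 2|V|. -/
theorem binomialEdgeIdeal_height_eq (K : Type*) [Field K] [Finite V] :
    (binomialEdgeIdeal K G).height = (2 * Nat.card V - G.maxSizeAddComponents : ℕ) := by
  have h := (binomialEdgeIdeal_height_add_eq_and_dim_eq G K).1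
  have hle := G.maxSizeAddComponents_le_two_mul
  generalize (binomialEdgeIdeal K G).height = a at h
  induction a using ENat.recTopCoe with
  | top =>
    rw [top_add] at h
    exact (ENat.natCast_ne_top _ h.symm).elim
  | coe a =>
    norm_cast at h ⊢
    omega

theorem ringKrullDim_quotient_binomialEdgeIdeal (K : Type*) [Field K] [Finite V] :
    ringKrullDim (EdgeRing K V ⧸ binomialEdgeIdeal K G) = G.maxSizeAddComponents :=
  (binomialEdgeIdeal_height_add_eq_and_dim_eq G K).2

theorem sum_maxSizeAddComponents [Finite V] {r : ℕ} (c : Fin r ≃ G.ConnectedComponent) :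
    ∑ i, (c i).toSimpleGraph.maxSizeAddComponents = G.maxSizeAddComponents := by
  have := Fintype.ofFinite G.ConnectedComponent
  rw [G.maxSizeAddComponents_eq_sum, ← c.sum_comp]

theorem sum_binomialEdgeIdeal_height (K : Type*) [Field K] [Finite V] {r : ℕ}
    (c : Fin r ≃ G.ConnectedComponent) :
    ∑ i, (binomialEdgeIdeal K (c i).toSimpleGraph).height =
      (2 * Nat.card V - G.maxSizeAddComponents : ℕ) := by
  have := Fintype.ofFinite G.ConnectedComponent
  have hcard : ∑ i, Nat.card (c i) = Nat.card V := by
    have := G.ncard_eq_sum Set.univ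
    simpa [Set.ncard_univ, ← c.sum_comp] using this.symm
  have hsum : ∑ i, (2 * Nat.card (c i) - (c i).toSimpleGraph.maxSizeAddComponents) +
      ∑ i, (c i).toSimpleGraph.maxSizeAddComponents = 2 * Nat.card V := by
    rw [← hcard, Finset.mul_sum, ← Finset.sum_add_distrib]
    exact Finset.sum_congr rfl fun i _ =>
      Nat.sub_add_cancel (c i).toSimpleGraph.maxSizeAddComponents_le_two_mul
  rw [sum_maxSizeAddComponents] at hsum
  simp only [binomialEdgeIdeal_height_eq]
  rw [← Nat.cast_sum, Nat.eq_sub_of_add_eq hsum]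

end

/-! ### The three statements for the join. -/

theorem proposition4p10 {K : Type*} [Field K] {V₁ V₂ : Type*} [Fintype V₁] [Fintype V₂]
    (G₁ : SimpleGraph V₁) (G₂ : SimpleGraph V₂) {r s : ℕ} (hr : 2 ≤ r) (hs : 2 ≤ s)
    (c₁ : Fin r ≃ G₁.ConnectedComponent) (c₂ : Fin s ≃ G₂.ConnectedComponent) :
    -- (a) the sets with the cut point property
    (cutPointSets (graphJoin G₁ G₂) =
      {∅}
      ∪ joinCollections
          (Set.image Sum.inl '' iJoinCollections fun i : Fin r =>
            liftCollection (c₁ i) (cutPointSets (c₁ i).toSimpleGraph))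
          {Set.range Sum.inr}
      ∪ joinCollections
          (Set.image Sum.inr '' iJoinCollections fun j : Fin s =>
            liftCollection (c₂ j) (cutPointSets (c₂ j).toSimpleGraph))
          {Set.range Sum.inl})
    -- (b) the height
    ∧ (binomialEdgeIdeal K (graphJoin G₁ G₂)).height =
        min (2 * (Fintype.card V₂ : ℕ∞)
              + ∑ i : Fin r, (binomialEdgeIdeal K (c₁ i).toSimpleGraph).height)
          (min (2 * (Fintype.card V₁ : ℕ∞)
              + ∑ j : Fin s, (binomialEdgeIdeal K (c₂ j).toSimpleGraph).height)
            ((Fintype.card V₁ + Fintype.card V₂ - 1 : ℕ) : ℕ∞))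
    -- (c) the dimension
    ∧ ringKrullDim (EdgeRing K (V₁ ⊕ V₂) ⧸ binomialEdgeIdeal K (graphJoin G₁ G₂)) =
        max (∑ i : Fin r,
              ringKrullDim (EdgeRing K (c₁ i) ⧸ binomialEdgeIdeal K (c₁ i).toSimpleGraph))
          (max (∑ j : Fin s,
              ringKrullDim (EdgeRing K (c₂ j) ⧸ binomialEdgeIdeal K (c₂ j).toSimpleGraph))
            ((Fintype.card V₁ + Fintype.card V₂ + 1 : ℕ) : WithBot ℕ∞)) := by
  have hr' : 2 ≤ Nat.card G₁.ConnectedComponent := by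
    rwa [← Nat.card_congr c₁, Nat.card_fin]
  have hs' : 2 ≤ Nat.card G₂.ConnectedComponent := by
    rwa [← Nat.card_congr c₂, Nat.card_fin]
  have : Nonempty V₁ := ⟨(c₁ ⟨0, by omega⟩).nonempty_supp.some⟩
  have : Nonempty V₂ := ⟨(c₂ ⟨0, by omega⟩).nonempty_supp.some⟩
  refine ⟨?_, ?_, ?_⟩
  · rw [iJoinCollections_liftCollection_cutPointSets, iJoinCollections_liftCollection_cutPointSets]
    ext T
    rw [mem_cutPointSets_graphJoin_iff G₁ G₂ hr' hs']
    simp [joinCollections, or_assoc]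
  · have h1 := G₁.maxSizeAddComponents_le_two_mul
    have h2 := G₂.maxSizeAddComponents_le_two_mul
    have h3 : 0 < Nat.card V₁ := Nat.card_pos
    rw [binomialEdgeIdeal_height_eq, sum_binomialEdgeIdeal_height, sum_binomialEdgeIdeal_height,
      maxSizeAddComponents_graphJoin, Nat.card_sum]
    simp only [Nat.card_eq_fintype_card] at h1 h2 h3 ⊢
    -- What remains is an identity in ℕ: subtracting d₁, d₂ and n₁ + n₂ + 1 from 2(n₁ + n₂) turns
    -- the maximum into the minimum.
    rw [← Nat.cast_ofNat (R := ℕ∞), ← Nat.cast_mul, ← Nat.cast_mul, ← Nat.cast_add,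
      ← Nat.cast_add, ← Nat.mono_cast.map_min, ← Nat.mono_cast.map_min, Nat.cast_inj]
    omega
  · simp only [ringKrullDim_quotient_binomialEdgeIdeal]
    rw [maxSizeAddComponents_graphJoin, ← sum_maxSizeAddComponents G₁ c₁,
      ← sum_maxSizeAddComponents G₂ c₂]
    simp only [Nat.card_eq_fintype_card, ← Nat.cast_sum, ← Nat.mono_cast.map_max]
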